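/- Theorem (Informativity for quadratic stabilization). Consider an unknown system $x(t+1)=A_s x(t)+B_s u(t)+w(t)$ with $A_s\in\mathbb{R}^{n\times n}$, $B_s\in\mathbb{R}^{n\times m}$. Measurements give $U_-=[u(0)\ \cdots\ u(T-1)]$ and $X=[x(0)\ \cdots\ x(T)]$; let $X_-=[x(0)\ \cdots\ x(T-1)]$ and $X_+=[x(1)\ \cdots\ x(T)]$. Let $$\Phi=\begin{bmatrix}\Phi_{11}&\Phi_{12}\\ \Phi_{21}&\Phi_{22}\end{bmatrix}\in\mathbf{\Pi}_{n,T},$$ that is, $\Phi\in\mathbb{R}^{(n+T)\times(n+T)}$ is symmetric, $\Phi_{11}\in\mathbb{R}^{n\times n}$, $\Phi_{22}\le 0$, $\Phi_{11}-\Phi_{12}\Phi_{22}^\dagger\Phi_{21}\ge 0$ and $\ker\Phi_{22}\subseteq\ker\Phi_{12}$, where $\dagger$ denotes the Moore-Penrose pseudo-inverse. The data $(U_-,X)$ are generated by the unknown system, so $X_+=A_sX_-+B_sU_-+W_-$, where the unknown noise matrix $W_-=[w(0)\ \cdots\ w(T-1)]$ satisfies $$\begin{bmatrix}I\\ W_-^\top\end{bmatrix}^\top\Phi\begin{bmatrix}I\\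 W_-^\top\end{bmatrix}\ge 0.\qquad(1)$$ Let $\Sigma_{\mathcal D}$ be the set of all $(A,B)\in\mathbb{R}^{n\times n}\times\mathbb{R}^{n\times m}$ such that $X_+=AX_-+BU_-+W$ for some $W\in\mathbb{R}^{n\times T}$ satisfying (1) in place of $W_-$. The data are called informative for quadratic stabilization if there exist $K\in\mathbb{R}^{m\times n}$ and a symmetric $P\in\mathbb{R}^{n\times n}$, $P>0$, such that $P-(A+BK)P(A+BK)^\top>0$ for all $(A,B)\in\Sigma_{\mathcal D}$. Put $$N=\begin{bmatrix}I&X_+\\0&-X_-\\0&-U_-\end{bmatrix}\Phi\begin{bmatrix}I&X_+\\0&-X_-\\0&-U_-\end{bmatrix}^\top\in\mathbb{R}^{(2n+m)\times(2n+m)}.$$ Then the data $(U_-,X)$ are informative for quadratic stabilization if and only if there exist a symmetric $P\in\mathbb{R}^{n\times n}$, $P>0$, a matrix $L\in\mathbb{R}^{m\times n}$ and a scalar $\beta>0$ such that $$\begin{bmatrix}P-\beta I&0&0&0\\0&-P&-L^\top&0\\0&-L&0&L\\0&0&L^\top&P\end{bmatrix}-\begin{bmatrix}N&0\\0&0\end{bmatrix}\ge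 0.\qquad(2)$$ The size of the linear matrix inequality (2) is $(3n+m)\times(3n+m)$, independent of $T$. Moreover, if $P>0$, $L$ and $\beta>0$ satisfy (2), then $K:=LP^{-1}$ is a stabilizing feedback gain for all $(A,B)\in\Sigma_{\mathcal D}$: every complex eigenvalue of $A+BK$ has modulus less than $1$. -/

import Mathlib

namespace DataInformativity

open Matrix

/-- The four Penrose equations: `X` is the Moore-Penrose pseudo-inverse of the real matrix `A`. -/
structure IsMoorePenrose {p q : Type*} [Fintype p] [Fintype q]
    (A : Matrix p q ℝ) (X : Matrix q p ℝ) : Prop where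
  mul_mul_left : A * X * A = A
  mul_mul_right : X * A * X = X
  symm_left : (A * X)ᵀ = A * X
  symm_right : (X * A)ᵀ = X * A

theorem IsMoorePenrose.unique {p q : Type*} [Fintype p] [Fintype q]
    {A : Matrix p q ℝ} {X Y : Matrix q p ℝ}
    (hX : IsMoorePenrose A X) (hY : IsMoorePenrose A Y) : X = Y := by
  have h1 : A * X = A * Y := by
    calc A * X = (A * Y * A) * X := by rw [hY.mul_mul_left]
      _ = (A * Y)ᵀ * (A * X)ᵀ := by rw [hY.symm_left, hX.symm_left, Matrix.mul_assoc (A * Y)]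
      _ = ((A * X * A) * Y)ᵀ := by rw [← Matrix.transpose_mul, Matrix.mul_assoc (A * X)]
      _ = A * Y := by rw [hX.mul_mul_left, hY.symm_left]
  have h2 : X * A = Y * A := by
    calc X * A = X * (A * Y * A) := by rw [hY.mul_mul_left]
      _ = (X * A)ᵀ * (Y * A)ᵀ := by
          rw [hY.symm_right, hX.symm_right, Matrix.mul_assoc A, Matrix.mul_assoc X]
      _ = (Y * (A * X * A))ᵀ := by
          rw [← Matrix.transpose_mul, Matrix.mul_assoc A, Matrix.mul_assoc Y]
      _ = Y * A := by rw [hX.mul_mul_left, hY.symm_right]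
  calc X = X * A * X := hX.mul_mul_right.symm
    _ = Y * A * Y := by rw [h2, Matrix.mul_assoc, h1, Matrix.mul_assoc]
    _ = Y := hY.mul_mul_right

theorem exists_isMoorePenrose_of_isHermitian {p : Type*} [Fintype p] [DecidableEq p]
    {S : Matrix p p ℝ} (hS : S.IsHermitian) : ∃ G, IsMoorePenrose S G ∧ Gᵀ = G := by
  let V : Matrix p p ℝ := (hS.eigenvectorUnitary : Matrix p p ℝ)
  let d : p → ℝ := hS.eigenvalues
  have hV : Vᵀ * V = 1 := by
    have h := Unitary.coe_star_mul_self hS.eigenvectorUnitary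
    simpa [Matrix.star_eq_conjTranspose, Matrix.conjTranspose_eq_transpose_of_trivial] using h
  have hSV : S = V * diagonal d * Vᵀ := by
    have h := hS.spectral_theorem
    simpa [Unitary.conjStarAlgAut_apply, Matrix.star_eq_conjTranspose,
      Matrix.conjTranspose_eq_transpose_of_trivial, Function.comp_def] using h
  have key : ∀ a b : p → ℝ, (V * diagonal a * Vᵀ) * (V * diagonal b * Vᵀ)
      = V * diagonal (fun i => a i * b i) * Vᵀ := by
    intro a b
    calc (V * diagonal a * Vᵀ) * (V * diagonal b * Vᵀ)
        = V * diagonal a * (Vᵀ * V) * diagonal b * Vᵀ := by simp only [Matrix.mul_assoc]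
      _ = _ := by rw [hV, Matrix.mul_one, Matrix.mul_assoc V, diagonal_mul_diagonal]
  have symm : ∀ a : p → ℝ, (V * diagonal a * Vᵀ)ᵀ = V * diagonal a * Vᵀ := by
    intro a
    simp [Matrix.transpose_mul, Matrix.mul_assoc]
  refine ⟨V * diagonal (fun i => (d i)⁻¹) * Vᵀ, ⟨?_, ?_, ?_, ?_⟩, symm _⟩
  · rw [hSV, key, key]
    simp only [mul_inv_mul_cancel]
  · rw [hSV, key, key]
    have : ∀ i, (d i)⁻¹ * d i * (d i)⁻¹ = (d i)⁻¹ := fun i => by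
      simpa using mul_inv_mul_cancel (d i)⁻¹
    simp only [this]
  · rw [hSV, key, symm]
  · rw [hSV, key, symm]

theorem exists_isMoorePenrose {p q : Type*} [Fintype p] [Fintype q]
    (A : Matrix p q ℝ) : ∃ X, IsMoorePenrose A X := by
  classical
  have hS : (Aᵀ * A).IsHermitian := by
    simpa [Matrix.conjTranspose_eq_transpose_of_trivial] using
      Matrix.isHermitian_conjTranspose_mul_self A
  obtain ⟨G, hG, hGs⟩ := exists_isMoorePenrose_of_isHermitian hS
  refine ⟨G * Aᵀ, ⟨?_, ?_, ?_, ?_⟩⟩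
  · have h : Aᵀ * A * (G * (Aᵀ * A) - 1) = 0 := by
      rw [Matrix.mul_sub, ← Matrix.mul_assoc, hG.mul_mul_left, Matrix.mul_one, sub_self]
    have h' : A * (G * (Aᵀ * A) - 1) = 0 := by
      rw [← Matrix.conjTranspose_eq_transpose_of_trivial] at h
      exact (Matrix.conjTranspose_mul_self_mul_eq_zero A _).1 (by
        simpa [Matrix.conjTranspose_eq_transpose_of_trivial] using h)
    rw [Matrix.mul_sub, Matrix.mul_one, sub_eq_zero] at h'
    simpa only [Matrix.mul_assoc] using h'
  · have h := congrArg (fun Z => Z * Aᵀ) hG.mul_mul_right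
    simpa only [Matrix.mul_assoc] using h
  · simp [Matrix.transpose_mul, hGs, Matrix.mul_assoc]
  · have h := hG.symm_right
    simpa only [Matrix.mul_assoc] using h

/-- The Moore-Penrose pseudo-inverse of a real matrix. -/
noncomputable def pinv {p q : Type*} [Fintype p] [Fintype q] (A : Matrix p q ℝ) :
    Matrix q p ℝ :=
  Classical.choose (exists_isMoorePenrose A)

theorem isMoorePenrose_pinv {p q : Type*} [Fintype p] [Fintype q] (A : Matrix p q ℝ) :
    IsMoorePenrose A (pinv A) :=
  Classical.choose_spec (exists_isMoorePenrose A)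

/-- The set of symmetric matrices `Φ`, partitioned with diagonal blocks indexed by `q` and `r`,
such that `Φ₂₂ ≤ 0`, the generalized Schur complement `Φ₁₁ - Φ₁₂ Φ₂₂† Φ₂₁` is positive
semidefinite, and `ker Φ₂₂ ⊆ ker Φ₁₂`. -/
def qmiSet (q r : Type*) [Fintype q] [Fintype r] : Set (Matrix (q ⊕ r) (q ⊕ r) ℝ) :=
  {Φ | Φ.IsSymm ∧ (-Φ.toBlocks₂₂).PosSemidef ∧
    (Φ.toBlocks₁₁ - Φ.toBlocks₁₂ * pinv Φ.toBlocks₂₂ * Φ.toBlocks₂₁).PosSemidef ∧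
    LinearMap.ker Φ.toBlocks₂₂.mulVecLin ≤ LinearMap.ker Φ.toBlocks₁₂.mulVecLin}

/-- The noise bound `[I; Wᵀ]ᵀ Φ [I; Wᵀ] ≥ 0` on the matrix `W` of noise samples. -/
def SatisfiesNoiseBound {n T : ℕ} (Φ : Matrix (Fin n ⊕ Fin T) (Fin n ⊕ Fin T) ℝ)
    (W : Matrix (Fin n) (Fin T) ℝ) : Prop :=
  ((fromRows (1 : Matrix (Fin n) (Fin n) ℝ) Wᵀ)ᵀ * Φ *
    fromRows (1 : Matrix (Fin n) (Fin n) ℝ) Wᵀ).PosSemidef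

/-- The first `T` columns `x(0), …, x(T-1)` of the state data. -/
def Xminus {n T : ℕ} (X : Matrix (Fin n) (Fin (T + 1)) ℝ) : Matrix (Fin n) (Fin T) ℝ :=
  X.submatrix id Fin.castSucc

/-- The last `T` columns `x(1), …, x(T)` of the state data. -/
def Xplus {n T : ℕ} (X : Matrix (Fin n) (Fin (T + 1)) ℝ) : Matrix (Fin n) (Fin T) ℝ :=
  X.submatrix id Fin.succ

/-- The set of all systems `(A, B)` consistent with the data. -/
def consistentSystems {n m T : ℕ} (Φ : Matrix (Fin n ⊕ Fin T) (Fin n ⊕ Fin T) ℝ)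
    (U : Matrix (Fin m) (Fin T) ℝ) (X : Matrix (Fin n) (Fin (T + 1)) ℝ) :
    Set (Matrix (Fin n) (Fin n) ℝ × Matrix (Fin n) (Fin m) ℝ) :=
  {S | ∃ W : Matrix (Fin n) (Fin T) ℝ,
    SatisfiesNoiseBound Φ W ∧ Xplus X = S.1 * Xminus X + S.2 * U + W}

/-- Informativity for quadratic stabilization: one gain `K` and one Lyapunov matrix `P` for all
consistent systems. -/
def InformativeForQuadraticStabilization {n m T : ℕ}
    (Φ : Matrix (Fin n ⊕ Fin T) (Fin n ⊕ Fin T) ℝ)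
    (U : Matrix (Fin m) (Fin T) ℝ) (X : Matrix (Fin n) (Fin (T + 1)) ℝ) : Prop :=
  ∃ (K : Matrix (Fin m) (Fin n) ℝ) (P : Matrix (Fin n) (Fin n) ℝ), P.PosDef ∧
    ∀ (A : Matrix (Fin n) (Fin n) ℝ) (B : Matrix (Fin n) (Fin m) ℝ),
      (A, B) ∈ consistentSystems Φ U X →
        (P - (A + B * K) * P * (A + B * K)ᵀ).PosDef

/-- The matrix `[I, X₊; 0, -X₋; 0, -U₋]`. -/
def dataMatrix {n m T : ℕ} (U : Matrix (Fin m) (Fin T) ℝ) (X : Matrix (Fin n) (Fin (T + 1)) ℝ) :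
    Matrix (Fin n ⊕ (Fin n ⊕ Fin m)) (Fin n ⊕ Fin T) ℝ :=
  fromBlocks 1 (Xplus X) 0 (fromRows (-Xminus X) (-U))

/-- `N = [I, X₊; 0, -X₋; 0, -U₋] Φ [I, X₊; 0, -X₋; 0, -U₋]ᵀ`. -/
def dataN {n m T : ℕ} (Φ : Matrix (Fin n ⊕ Fin T) (Fin n ⊕ Fin T) ℝ)
    (U : Matrix (Fin m) (Fin T) ℝ) (X : Matrix (Fin n) (Fin (T + 1)) ℝ) :
    Matrix (Fin n ⊕ (Fin n ⊕ Fin m)) (Fin n ⊕ (Fin n ⊕ Fin m)) ℝ :=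
  dataMatrix U X * Φ * (dataMatrix U X)ᵀ

/-- Row and column index of the linear matrix inequality: blocks of sizes `n, n, m, n`. -/
abbrev LMIIndex (n m : ℕ) : Type := (Fin n ⊕ (Fin n ⊕ Fin m)) ⊕ Fin n

/-- The left-hand side of the linear matrix inequality,
`[P - βI, 0, 0, 0; 0, -P, -Lᵀ, 0; 0, -L, 0, L; 0, 0, Lᵀ, P] - [N, 0; 0, 0]`. -/
def lmiMatrix {n m : ℕ} (N : Matrix (Fin n ⊕ (Fin n ⊕ Fin m)) (Fin n ⊕ (Fin n ⊕ Fin m)) ℝ)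
    (P : Matrix (Fin n) (Fin n) ℝ) (L : Matrix (Fin m) (Fin n) ℝ) (β : ℝ) :
    Matrix (LMIIndex n m) (LMIIndex n m) ℝ :=
  fromBlocks
    (fromBlocks (P - β • (1 : Matrix (Fin n) (Fin n) ℝ)) 0 0 (fromBlocks (-P) (-Lᵀ) (-L) 0))
    (fromRows 0 (fromRows 0 L))
    (fromCols 0 (fromCols 0 Lᵀ))
    P
  - fromBlocks N 0 0 0

/-- Schur stability: all complex eigenvalues have modulus less than one. -/
def IsSchurStable {n : ℕ} (A : Matrix (Fin n) (Fin n) ℝ) : Prop :=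
  ∀ z : ℂ, Module.End.HasEigenvalue (Matrix.toLin' (A.map Complex.ofReal)) z → ‖z‖ < 1

end DataInformativity

namespace DataInformativity

open Matrix

/-! In transposed coordinates, (A, B) is consistent with the data iff the form of N is nonnegative
at (x, Aᵀx, Bᵀx) for every x. The Lyapunov inequality for a gain K says that xᵀPx - (y + Kᵀw)ᵀP(y +
Kᵀw) is positive at the same points with x ≠ 0. A Schur complement turns the LMI, with K = LP⁻¹,
into the bound "form of N plus β|x|² ≤ Lyapunov form" for all (x, y, w). Sufficiency is then
substitution.

Necessity is a strict matrix S-lemma without a Slater condition,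
`exists_multiplier_of_quadratic_matrix_inequality`. The kernel condition allows completing the
square, so the form of N becomes xᵀSx - uᵀDu with D ≥ 0; S ≥ 0 because a consistent system exists.
By rank-one interpolation, every pair (x, u) with x ≠ 0 on which this form is nonnegative comes from
a consistent system, so the hypothesis on matrices becomes one on vectors. Along ker D the vector u
is unconstrained, which forces the Lyapunov form to ignore ker D. Modulo ker D the implication is
strict at every nonzero vector, compactness gives a uniform margin, and the scalar S-lemma for
slightly perturbed forms yields multipliers α and β. Positivity of P excludes α = 0, and dividing by
α gives the LMI. -/

/-! ### The scalar S-lemma on a subspace. -/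

theorem dotProduct_mulVec_add_smul {ι : Type*} [Fintype ι] (M : Matrix ι ι ℝ) (w v : ι → ℝ)
    (t : ℝ) : (w + t • v) ⬝ᵥ M *ᵥ (w + t • v) =
      w ⬝ᵥ M *ᵥ w + t * (w ⬝ᵥ M *ᵥ v + v ⬝ᵥ M *ᵥ w) + t ^ 2 * (v ⬝ᵥ M *ᵥ v) := by
  simp only [mulVec_add, mulVec_smul, dotProduct_add, add_dotProduct, smul_dotProduct,
    dotProduct_smul, smul_eq_mul]
  ring

/-- Two real quadratic polynomials: if the first has negative constant and positive leading
coefficient, and the second is nonnegative wherever the first is, their coefficients compare. -/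
theorem mul_le_mul_of_quadratic_implication {a b c a' b' c' : ℝ} (hc : c < 0) (ha : 0 < a)
    (h : ∀ t : ℝ, 0 ≤ c + t * b + t ^ 2 * a → 0 ≤ c' + t * b' + t ^ 2 * a') :
    a' * c ≤ c' * a := by
  set r := Real.sqrt (b ^ 2 - 4 * a * c) with hr
  have hdisc : b ^ 2 < b ^ 2 - 4 * a * c := by nlinarith
  have hr2 : r ^ 2 = b ^ 2 - 4 * a * c := Real.sq_sqrt (by nlinarith [sq_nonneg b])
  have hr0 : 0 ≤ r := Real.sqrt_nonneg _
  have hbr : |b| < r := abs_lt_of_sq_lt_sq (by linarith) hr0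
  obtain ⟨hb1, hb2⟩ := abs_lt.1 hbr
  have root : ∀ s : ℝ, s ^ 2 = b ^ 2 - 4 * a * c →
      0 ≤ 4 * a ^ 2 * c' + 2 * a * (s - b) * b' + (s - b) ^ 2 * a' := by
    intro s hs
    have h1 := h ((s - b) / (2 * a)) (le_of_eq (by field_simp; nlinarith))
    have h2 := mul_nonneg (by positivity : (0 : ℝ) ≤ 4 * a ^ 2) h1
    refine h2.trans (le_of_eq ?_)
    field_simp
    ring
  have h1 := root r hr2
  have h2 := root (-r) (by rw [neg_sq, hr2])
  -- The second polynomial is nonnegative at both roots (±r - b) / 2a of the first. The weights r ±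
  -- b are positive and cancel the coefficient b'.
  have h3 := add_nonneg (mul_nonneg (by linarith : 0 ≤ r + b) h1)
    (mul_nonneg (by linarith : 0 ≤ r - b) h2)
  have h4 : (r + b) * (4 * a ^ 2 * c' + 2 * a * (r - b) * b' + (r - b) ^ 2 * a') +
      (r - b) * (4 * a ^ 2 * c' + 2 * a * (-r - b) * b' + (-r - b) ^ 2 * a') =
      8 * a * r * (c' * a - a' * c) := by
    linear_combination (2 * r * a') * hr2
  rw [h4] at h3
  have hrpos : 0 < r := lt_of_le_of_lt (abs_nonneg b) hbr
  have := nonneg_of_mul_nonneg_right h3 (by positivity : 0 < 8 * a * r)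
  linarith

/-- The homogeneous S-lemma on a subspace, under a Slater condition. -/
theorem exists_multiplier_of_implication {ι : Type*} [Fintype ι] (M N : Matrix ι ι ℝ)
    (V : Submodule ℝ (ι → ℝ)) (hslater : ∃ v ∈ V, 0 < v ⬝ᵥ N *ᵥ v)
    (h : ∀ v ∈ V, 0 ≤ v ⬝ᵥ N *ᵥ v → 0 ≤ v ⬝ᵥ M *ᵥ v) :
    ∃ α : ℝ, 0 ≤ α ∧ ∀ v ∈ V, α * (v ⬝ᵥ N *ᵥ v) ≤ v ⬝ᵥ M *ᵥ v := by
  -- The infimum of these quotients is the largest multiplier allowed where the form of N is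
  -- positive. It also works where that form is negative, by comparing the two forms along lines w +
  -- t v.
  let R : Set ℝ := {r | ∃ v ∈ V, 0 < v ⬝ᵥ N *ᵥ v ∧ r = (v ⬝ᵥ M *ᵥ v) / (v ⬝ᵥ N *ᵥ v)}
  have hR : R.Nonempty := by
    obtain ⟨v, hv, hN⟩ := hslater
    exact ⟨_, v, hv, hN, rfl⟩
  have hR0 : ∀ r ∈ R, 0 ≤ r := by
    rintro r ⟨v, hv, hN, rfl⟩
    exact div_nonneg (h v hv hN.le) hN.le
  refine ⟨sInf R, le_csInf hR hR0, fun w hw => ?_⟩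
  rcases lt_trichotomy (w ⬝ᵥ N *ᵥ w) 0 with hN | hN | hN
  · have h1 : (w ⬝ᵥ M *ᵥ w) / (w ⬝ᵥ N *ᵥ w) ≤ sInf R := by
      refine le_csInf hR ?_
      rintro r ⟨v, hv, hNv, rfl⟩
      have key := mul_le_mul_of_quadratic_implication (b := w ⬝ᵥ N *ᵥ v + v ⬝ᵥ N *ᵥ w)
        (a' := v ⬝ᵥ M *ᵥ v) (b' := w ⬝ᵥ M *ᵥ v + v ⬝ᵥ M *ᵥ w) (c' := w ⬝ᵥ M *ᵥ w) hN hNv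
        (fun t ht => by
          rw [← dotProduct_mulVec_add_smul] at ht ⊢
          exact h _ (V.add_mem hw (V.smul_mem t hv)) ht)
      rw [div_le_iff_of_neg hN, div_mul_eq_mul_div, div_le_iff₀ hNv]
      exact key
    exact (div_le_iff_of_neg hN).1 h1
  · rw [hN, mul_zero]
    exact h w hw hN.ge
  · exact (le_div_iff₀ hN).1 (csInf_le ⟨0, hR0⟩ ⟨w, hw, hN, rfl⟩)

/-- The strict homogeneous S-lemma on a subspace. -/
theorem exists_multiplier_of_strict_implication {ι : Type*} [Fintype ι] (M N : Matrix ι ι ℝ)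
    (V : Submodule ℝ (ι → ℝ)) (hN : ∃ v ∈ V, v ≠ 0 ∧ 0 ≤ v ⬝ᵥ N *ᵥ v)
    (h : ∀ v ∈ V, v ≠ 0 → 0 ≤ v ⬝ᵥ N *ᵥ v → 0 < v ⬝ᵥ M *ᵥ v) :
    ∃ α β : ℝ, 0 ≤ α ∧ 0 < β ∧
      ∀ v ∈ V, α * (v ⬝ᵥ N *ᵥ v) + β * (v ⬝ᵥ v) ≤ v ⬝ᵥ M *ᵥ v := by
  classical
  have hpos : ∀ v : ι → ℝ, v ≠ 0 → 0 < v ⬝ᵥ v := fun v hv =>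
    lt_of_le_of_ne (Finset.sum_nonneg fun i _ => mul_self_nonneg _)
      (fun h0 => hv (dotProduct_self_eq_zero.1 h0.symm))
  let K : Set (ι → ℝ) := {v | v ∈ V ∧ v ⬝ᵥ v = 1}
  have hscale : ∀ v ∈ V, v ≠ 0 → (Real.sqrt (v ⬝ᵥ v))⁻¹ • v ∈ K := by
    intro v hv hv0
    refine ⟨V.smul_mem _ hv, ?_⟩
    have := hpos v hv0
    rw [smul_dotProduct, dotProduct_smul, smul_eq_mul, smul_eq_mul, ← mul_assoc, ← mul_inv,
      Real.mul_self_sqrt this.le, inv_mul_cancel₀ this.ne']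
  have hK : IsCompact K := by
    refine Metric.isCompact_of_isClosed_isBounded ?_ ?_
    · exact (Submodule.closed_of_finiteDimensional V).inter
        (isClosed_eq (by unfold dotProduct; fun_prop) continuous_const)
    · refine (Metric.isBounded_closedBall (x := (0 : ι → ℝ)) (r := 1)).subset ?_
      rintro v ⟨-, hv⟩
      rw [mem_closedBall_zero_iff, pi_norm_le_iff_of_nonneg zero_le_one]
      intro i
      have : v i * v i ≤ v ⬝ᵥ v :=
        Finset.single_le_sum (f := fun j => v j * v j) (fun j _ => mul_self_nonneg _)
          (Finset.mem_univ i)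
      rw [Real.norm_eq_abs]
      exact abs_le_one_iff_mul_self_le_one.2 (this.trans hv.le)
  obtain ⟨v₀, hv₀, hv₀0, hNv₀⟩ := hN
  -- On the unit sphere of V one of M, -N is always positive, so the minimum of their maximum is a
  -- uniform margin ε > 0.
  obtain ⟨e, he, hmin⟩ := hK.exists_isMinOn ⟨_, hscale v₀ hv₀ hv₀0⟩
    (f := fun v => max (v ⬝ᵥ M *ᵥ v) (-(v ⬝ᵥ N *ᵥ v)))
    (by unfold dotProduct mulVec dotProduct; fun_prop)
  set ε := max (e ⬝ᵥ M *ᵥ e) (-(e ⬝ᵥ N *ᵥ e)) with hε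
  have hε0 : 0 < ε := by
    have he0 : e ≠ 0 := by
      rintro rfl
      simpa using he.2
    rcases lt_or_ge (e ⬝ᵥ N *ᵥ e) 0 with h1 | h1
    · exact lt_max_of_lt_right (neg_pos.2 h1)
    · exact lt_max_of_lt_left (h e he.1 he0 h1)
  have hbound : ∀ v ∈ V, ε * (v ⬝ᵥ v) ≤ max (v ⬝ᵥ M *ᵥ v) (-(v ⬝ᵥ N *ᵥ v)) := by
    intro v hv
    rcases eq_or_ne v 0 with rfl | hv0
    · simp
    have h1 := hpos v hv0
    have h2 : ε ≤ _ := hmin (hscale v hv hv0)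
    have hs : (Real.sqrt (v ⬝ᵥ v))⁻¹ * (Real.sqrt (v ⬝ᵥ v))⁻¹ = (v ⬝ᵥ v)⁻¹ := by
      rw [← mul_inv, Real.mul_self_sqrt h1.le]
    simp only [mulVec_smul, smul_dotProduct, dotProduct_smul, smul_eq_mul, ← mul_assoc, hs,
      ← mul_neg] at h2
    rw [← mul_max_of_nonneg _ _ (inv_nonneg.2 h1.le), inv_mul_eq_div, le_div_iff₀ h1] at h2
    exact h2
  have hM' : ∀ v, v ⬝ᵥ (M - ε • 1) *ᵥ v = v ⬝ᵥ M *ᵥ v - ε * (v ⬝ᵥ v) := fun v => by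
    simp [sub_mulVec, smul_mulVec, dotProduct_sub]
  have hN' : ∀ v, v ⬝ᵥ (N + (ε / 2) • 1) *ᵥ v = v ⬝ᵥ N *ᵥ v + ε / 2 * (v ⬝ᵥ v) := fun v => by
    simp [add_mulVec, smul_mulVec, dotProduct_add]
  -- Adding ε/2 to N makes v₀ a Slater point. Since ε/2 < ε, nonnegativity of the perturbed N still
  -- rules out -N as the term attaining the margin.
  obtain ⟨α, hα, hmul⟩ := exists_multiplier_of_implication (M - ε • 1) (N + (ε / 2) • 1) V
    ⟨v₀, hv₀, by rw [hN']; have := hpos v₀ hv₀0; positivity⟩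
    (fun v hv hNv => by
      rw [hN'] at hNv
      rw [hM']
      rcases eq_or_ne v 0 with rfl | hv0
      · simp
      have h1 := mul_pos hε0 (hpos v hv0)
      rcases le_max_iff.1 (hbound v hv) with h2 | h2 <;> linarith)
  refine ⟨α, ε, hα, hε0, fun v hv => ?_⟩
  have h1 := hmul v hv
  rw [hM', hN'] at h1
  have h2 : 0 ≤ α * (ε / 2 * (v ⬝ᵥ v)) :=
    mul_nonneg hα (mul_nonneg (by positivity) (Finset.sum_nonneg fun i _ => mul_self_nonneg _))
  linarith

/-! ### Real semidefinite forms and rank-one interpolation. -/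

theorem dotProduct_mulVec_comm_of_isSymm {ι : Type*} [Fintype ι] {S : Matrix ι ι ℝ}
    (hS : S.IsSymm) (v w : ι → ℝ) : v ⬝ᵥ S *ᵥ w = w ⬝ᵥ S *ᵥ v := by
  rw [dotProduct_comm, ← vecMul_transpose, hS.eq, ← dotProduct_mulVec]

theorem isSymm_of_posSemidef {ι : Type*} {S : Matrix ι ι ℝ} (hS : S.PosSemidef) : S.IsSymm := by
  have := hS.isHermitian
  rwa [Matrix.IsHermitian, conjTranspose_eq_transpose_of_trivial] at this

theorem posSemidef_iff_real {ι : Type*} [Fintype ι] {S : Matrix ι ι ℝ} :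
    S.PosSemidef ↔ S.IsSymm ∧ ∀ v, 0 ≤ v ⬝ᵥ S *ᵥ v := by
  refine ⟨fun h => ⟨isSymm_of_posSemidef h, fun v => by
    simpa using h.dotProduct_mulVec_nonneg v⟩, fun h => ?_⟩
  refine .of_dotProduct_mulVec_nonneg ?_ fun v => by simpa using h.2 v
  rw [Matrix.IsHermitian, conjTranspose_eq_transpose_of_trivial]
  exact h.1

theorem posDef_iff_real {ι : Type*} [Fintype ι] {S : Matrix ι ι ℝ} :
    S.PosDef ↔ S.IsSymm ∧ ∀ v, v ≠ 0 → 0 < v ⬝ᵥ S *ᵥ v := by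
  refine ⟨fun h => ⟨isSymm_of_posSemidef h.posSemidef, fun v hv => by
    simpa using h.dotProduct_mulVec_pos hv⟩, fun h => ?_⟩
  refine .of_dotProduct_mulVec_pos ?_ fun v hv => by simpa using h.2 v hv
  rw [Matrix.IsHermitian, conjTranspose_eq_transpose_of_trivial]
  exact h.1

theorem mulVec_eq_zero_of_posSemidef {ι : Type*} [Fintype ι] {S : Matrix ι ι ℝ}
    (hS : S.PosSemidef) {v : ι → ℝ} (h : v ⬝ᵥ S *ᵥ v = 0) : S *ᵥ v = 0 :=
  (hS.dotProduct_mulVec_zero_iff v).1 (by simpa using h)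

theorem sq_dotProduct_mulVec_le {ι : Type*} [Fintype ι] {S : Matrix ι ι ℝ}
    (hS : S.PosSemidef) (v w : ι → ℝ) :
    (v ⬝ᵥ S *ᵥ w) ^ 2 ≤ (v ⬝ᵥ S *ᵥ v) * (w ⬝ᵥ S *ᵥ w) := by
  classical
  have hB : ∀ a b : ι → ℝ, Matrix.toBilin' S a b = a ⬝ᵥ S *ᵥ b := Matrix.toBilin'_apply' S
  have h := LinearMap.BilinForm.apply_mul_apply_le_of_forall_zero_le (Matrix.toBilin' S)
    (fun a => by rw [hB]; exact (posSemidef_iff_real.1 hS).2 a) v w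
  simp only [hB] at h
  rwa [dotProduct_mulVec_comm_of_isSymm (isSymm_of_posSemidef hS) w v, ← sq] at h

/-- A vector pair satisfying a quadratic inequality is interpolated by a rank-one matrix
satisfying the corresponding matrix inequality. -/
theorem exists_mulVec_eq_of_quadratic_le {p r : Type*} [Fintype p] [Fintype r]
    {S : Matrix p p ℝ} {D : Matrix r r ℝ} (hS : S.PosSemidef) (hD : D.PosSemidef)
    {x : p → ℝ} (hx : x ≠ 0) {u : r → ℝ} (hu : u ⬝ᵥ D *ᵥ u ≤ x ⬝ᵥ S *ᵥ x) :
    ∃ Y : Matrix r p ℝ, Y *ᵥ x = u ∧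
      ∀ z, (Y *ᵥ z) ⬝ᵥ D *ᵥ (Y *ᵥ z) ≤ z ⬝ᵥ S *ᵥ z := by
  have hY : ∀ (g z : p → ℝ), vecMulVec u g *ᵥ z = (g ⬝ᵥ z) • u := fun g z => by
    rw [vecMulVec_mulVec]; ext i; simp [mul_comm]
  obtain ⟨hSs, hS0⟩ := posSemidef_iff_real.1 hS
  have hD0 := (posSemidef_iff_real.1 hD).2
  rcases (hS0 x).eq_or_lt with h0 | h0
  · have hxx : x ⬝ᵥ x ≠ 0 := fun h => hx (dotProduct_self_eq_zero.1 h)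
    have hu0 : u ⬝ᵥ D *ᵥ u = 0 := le_antisymm (hu.trans h0.ge) (hD0 u)
    -- Here uᵀDu = 0, so any functional with value 1 at x will do.
    refine ⟨vecMulVec u ((x ⬝ᵥ x)⁻¹ • x), ?_, fun z => ?_⟩
    · rw [hY, smul_dotProduct, smul_eq_mul, inv_mul_cancel₀ hxx, one_smul]
    · rw [hY, mulVec_smul, smul_dotProduct, dotProduct_smul, hu0]
      simpa using hS0 z
  -- The functional is the S-orthogonal coordinate along x; Cauchy-Schwarz for S gives the bound.
  · refine ⟨vecMulVec u ((x ⬝ᵥ S *ᵥ x)⁻¹ • S *ᵥ x), ?_, fun z => ?_⟩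
    · rw [hY, smul_dotProduct, smul_eq_mul, dotProduct_comm (S *ᵥ x), inv_mul_cancel₀ h0.ne',
        one_smul]
    · rw [hY, mulVec_smul, smul_dotProduct, dotProduct_smul, smul_dotProduct,
        dotProduct_comm (S *ᵥ x)]
      simp only [smul_eq_mul]
      have h1 := sq_dotProduct_mulVec_le hS z x
      set a := x ⬝ᵥ S *ᵥ x
      set b := z ⬝ᵥ S *ᵥ x
      calc a⁻¹ * b * (a⁻¹ * b * (u ⬝ᵥ D *ᵥ u)) ≤ a⁻¹ * b * (a⁻¹ * b * a) := by
            have := mul_le_mul_of_nonneg_left hu (mul_self_nonneg (a⁻¹ * b))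
            linarith
        _ = b ^ 2 / a := by field_simp
        _ ≤ z ⬝ᵥ S *ᵥ z := by rwa [div_le_iff₀ h0]

/-- A positive semidefinite form bounded along a line vanishes on its direction. -/
theorem mulVec_eq_zero_of_bounded_on_line {r : Type*} [Fintype r] {E : Matrix r r ℝ}
    (hE : E.PosSemidef) (g y : r → ℝ) (c : ℝ)
    (h : ∀ s : ℝ, (g + s • y) ⬝ᵥ E *ᵥ (g + s • y) < c) : E *ᵥ y = 0 := by
  refine mulVec_eq_zero_of_posSemidef hE ?_
  have hE0 := (posSemidef_iff_real.1 hE).2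
  by_contra hne
  have hpos : 0 < y ⬝ᵥ E *ᵥ y := lt_of_le_of_ne (hE0 y) (Ne.symm hne)
  have hb : ∀ s : ℝ, s ^ 2 * (y ⬝ᵥ E *ᵥ y) < c := by
    intro s
    -- Averaging the bounds at s and -s removes the cross term.
    have h1 := h s
    have h2 := h (-s)
    rw [dotProduct_mulVec_add_smul] at h1 h2
    have := hE0 g
    nlinarith
  have hc : 0 < c := by simpa using hb 0
  have h1 := hb (Real.sqrt (c / (y ⬝ᵥ E *ᵥ y)))
  rw [Real.sq_sqrt (by positivity), div_mul_cancel₀ _ hpos.ne'] at h1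
  exact lt_irrefl _ h1

/-! ### The strict matrix S-lemma. -/

/-- Both forms depend on u only modulo ker D: adding multiples of a kernel vector keeps the
constraint, so E is bounded along a line and vanishes on its direction. On a complement of ker D, x
= 0 and uᵀDu ≤ 0 force u = 0, so the strict scalar S-lemma applies. -/
theorem exists_multiplier_of_centered {p r : Type*} [Fintype p] [Fintype r] [Nonempty p]
    {P S : Matrix p p ℝ} {D E : Matrix r r ℝ} (Z : Matrix r p ℝ) (hS : S.PosSemidef)
    (hD : D.PosSemidef) (hE : E.PosSemidef)
    (h : ∀ x, x ≠ 0 → ∀ u, u ⬝ᵥ D *ᵥ u ≤ x ⬝ᵥ S *ᵥ x →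
      (Z *ᵥ x + u) ⬝ᵥ E *ᵥ (Z *ᵥ x + u) < x ⬝ᵥ P *ᵥ x) :
    ∃ α β : ℝ, 0 ≤ α ∧ 0 < β ∧ ∀ x u,
      α * (x ⬝ᵥ S *ᵥ x - u ⬝ᵥ D *ᵥ u) + β * (x ⬝ᵥ x) ≤
        x ⬝ᵥ P *ᵥ x - (Z *ᵥ x + u) ⬝ᵥ E *ᵥ (Z *ᵥ x + u) := by
  classical
  obtain ⟨G, hG, -⟩ := exists_isMoorePenrose_of_isHermitian hD.isHermitian
  have hS0 := (posSemidef_iff_real.1 hS).2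
  have hD0 := (posSemidef_iff_real.1 hD).2
  obtain ⟨hDs, -⟩ := posSemidef_iff_real.1 hD
  obtain ⟨hEs, -⟩ := posSemidef_iff_real.1 hE
  have hker : ∀ y, D *ᵥ y = 0 → E *ᵥ y = 0 := by
    intro y hy
    refine mulVec_eq_zero_of_bounded_on_line hE (Z *ᵥ (fun _ => 1)) y _ fun s =>
      h (fun _ => 1) (fun h0 => ?_) (s • y) ?_
    · exact one_ne_zero (congrFun h0 (Classical.arbitrary p))
    · rw [mulVec_smul, hy]
      simpa using hS0 _
  let M : Matrix (p ⊕ r) (p ⊕ r) ℝ :=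
    fromBlocks P 0 0 0 - (fromCols Z 1)ᵀ * E * fromCols Z 1
  let N : Matrix (p ⊕ r) (p ⊕ r) ℝ := fromBlocks S 0 0 (-D)
  have hM : ∀ x u, Sum.elim x u ⬝ᵥ M *ᵥ Sum.elim x u =
      x ⬝ᵥ P *ᵥ x - (Z *ᵥ x + u) ⬝ᵥ E *ᵥ (Z *ᵥ x + u) := by
    intro x u
    have h1 : fromCols Z 1 *ᵥ Sum.elim x u = Z *ᵥ x + u := by simp [fromCols_mulVec]
    rw [sub_mulVec, dotProduct_sub, ← mulVec_mulVec, ← mulVec_mulVec,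
      dotProduct_mulVec _ (fromCols Z 1)ᵀ, vecMul_transpose, h1]
    simp [fromBlocks_mulVec, sumElim_dotProduct_sumElim]
  have hN : ∀ x u, Sum.elim x u ⬝ᵥ N *ᵥ Sum.elim x u = x ⬝ᵥ S *ᵥ x - u ⬝ᵥ D *ᵥ u := by
    intro x u
    simp [N, fromBlocks_mulVec, sumElim_dotProduct_sumElim, neg_mulVec, sub_eq_add_neg]
  -- G is a pseudo-inverse of D, so GD is a projection with kernel ker D; V requires u to lie in its
  -- range.
  let V : Submodule ℝ (p ⊕ r → ℝ) := LinearMap.ker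
    (fromBlocks (0 : Matrix p p ℝ) 0 0 (1 - G * D)).mulVecLin
  have hV : ∀ x u, Sum.elim x u ∈ V ↔ (G * D) *ᵥ u = u := by
    intro x u
    rw [LinearMap.mem_ker, mulVecLin_apply, fromBlocks_mulVec]
    simp only [Sum.elim_comp_inl, Sum.elim_comp_inr, zero_mulVec, zero_add, sub_mulVec,
      one_mulVec]
    constructor
    · intro h0
      have := congrArg (fun f => f ∘ Sum.inr) h0
      simp only [Sum.elim_comp_inr] at this
      exact (sub_eq_zero.1 this).symm
    · intro h0
      rw [h0, sub_self]
      ext (i | i) <;> simp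
  obtain ⟨α, β, hα, hβ, hmul⟩ := exists_multiplier_of_strict_implication M N V
    ⟨Sum.elim (fun _ => 1) 0, (hV _ _).2 (by simp), fun h0 =>
      one_ne_zero (congrFun h0 (Sum.inl (Classical.arbitrary p))), by
      rw [hN]; simpa using hS0 _⟩
    (fun v hv hv0 hNv => by
      obtain ⟨x, u, rfl⟩ : ∃ x u, v = Sum.elim x u :=
        ⟨v ∘ Sum.inl, v ∘ Sum.inr, (Sum.elim_comp_inl_inr v).symm⟩
      rw [hN] at hNv
      rw [hM]
      rw [hV] at hv
      rcases eq_or_ne x 0 with rfl | hx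
      · exfalso
        have hu0 : u ⬝ᵥ D *ᵥ u = 0 := le_antisymm (by simpa using hNv) (hD0 u)
        rw [← mulVec_mulVec, mulVec_eq_zero_of_posSemidef hD hu0, mulVec_zero] at hv
        apply hv0
        rw [← hv]
        ext (i | i) <;> rfl
      · exact sub_pos.2 (h x hx u (by linarith)))
  refine ⟨α, β, hα, hβ, fun x u => ?_⟩
  set u₁ := (G * D) *ᵥ u with hu₁
  have hDu : D *ᵥ u₁ = D *ᵥ u := by
    rw [hu₁, mulVec_mulVec, ← Matrix.mul_assoc, hG.mul_mul_left]
  have hEu : E *ᵥ u₁ = E *ᵥ u := by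
    rw [← sub_eq_zero, ← mulVec_sub]
    exact hker _ (by rw [mulVec_sub, hDu, sub_self])
  have h1 := hmul (Sum.elim x u₁) ((hV _ _).2 (by
    rw [hu₁, mulVec_mulVec, Matrix.mul_assoc, ← Matrix.mul_assoc D, hG.mul_mul_left]))
  rw [hM, hN, sumElim_dotProduct_sumElim] at h1
  have h2 : u₁ ⬝ᵥ D *ᵥ u₁ = u ⬝ᵥ D *ᵥ u := by
    rw [hDu, dotProduct_mulVec_comm_of_isSymm hDs, hDu]
  have h3 : (Z *ᵥ x + u₁) ⬝ᵥ E *ᵥ (Z *ᵥ x + u₁) = (Z *ᵥ x + u) ⬝ᵥ E *ᵥ (Z *ᵥ x + u) := by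
    have h4 : E *ᵥ (Z *ᵥ x + u₁) = E *ᵥ (Z *ᵥ x + u) := by
      rw [mulVec_add, hEu, ← mulVec_add]
    rw [h4, dotProduct_mulVec_comm_of_isSymm hEs, h4]
  have h5 : 0 ≤ u₁ ⬝ᵥ u₁ := Finset.sum_nonneg fun i _ => mul_self_nonneg _
  rw [h2, h3] at h1
  have := mul_nonneg hβ.le h5
  linarith

/-- For symmetric D the kernel inclusion says that the columns of C lie in the range of D, and D†C
is a solution. It supplies the centre for completing the square. -/
theorem exists_mul_eq_of_ker_le {p r : Type*} [Fintype p] [Fintype r]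
    {D : Matrix r r ℝ} {C : Matrix r p ℝ} (hD : D.IsSymm)
    (hker : ∀ v, D *ᵥ v = 0 → Cᵀ *ᵥ v = 0) : ∃ Z : Matrix r p ℝ, D * Z = C := by
  classical
  obtain ⟨G, hG, hGs⟩ := exists_isMoorePenrose_of_isHermitian (S := D)
    (by rw [Matrix.IsHermitian, conjTranspose_eq_transpose_of_trivial]; exact hD)
  refine ⟨G * C, ?_⟩
  have h1 : Cᵀ * (1 - G * D) = 0 := by
    refine ext_of_mulVec_single fun i => ?_
    rw [← mulVec_mulVec, zero_mulVec]
    apply hker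
    rw [mulVec_mulVec, Matrix.mul_sub, Matrix.mul_one, ← Matrix.mul_assoc, hG.mul_mul_left,
      sub_self, zero_mulVec]
  rw [Matrix.mul_sub, Matrix.mul_one, sub_eq_zero] at h1
  have h2 := congrArg transpose h1
  rw [transpose_mul, transpose_mul, hGs, hD.eq, transpose_transpose] at h2
  rw [← Matrix.mul_assoc]
  exact h2.symm

/-- The strict matrix S-lemma without Slater condition. -/
theorem exists_multiplier_of_quadratic_matrix_inequality {p r : Type*} [Fintype p] [Fintype r]
    [Nonempty p] {N₁₁ P : Matrix p p ℝ} {C : Matrix r p ℝ} {D E : Matrix r r ℝ}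
    (hN₁₁ : N₁₁.IsSymm) (hD : D.PosSemidef) (hE : E.PosSemidef)
    (hker : ∀ v, D *ᵥ v = 0 → Cᵀ *ᵥ v = 0)
    (hne : ∃ Z : Matrix r p ℝ, ∀ x, 0 ≤ x ⬝ᵥ N₁₁ *ᵥ x + 2 * ((Z *ᵥ x) ⬝ᵥ C *ᵥ x)
      - (Z *ᵥ x) ⬝ᵥ D *ᵥ (Z *ᵥ x))
    (h : ∀ Z : Matrix r p ℝ, (∀ x, 0 ≤ x ⬝ᵥ N₁₁ *ᵥ x + 2 * ((Z *ᵥ x) ⬝ᵥ C *ᵥ x)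
      - (Z *ᵥ x) ⬝ᵥ D *ᵥ (Z *ᵥ x)) → ∀ x, x ≠ 0 →
        (Z *ᵥ x) ⬝ᵥ E *ᵥ (Z *ᵥ x) < x ⬝ᵥ P *ᵥ x) :
    ∃ α β : ℝ, 0 ≤ α ∧ 0 < β ∧ ∀ x y,
      α * (x ⬝ᵥ N₁₁ *ᵥ x + 2 * (y ⬝ᵥ C *ᵥ x) - y ⬝ᵥ D *ᵥ y) + β * (x ⬝ᵥ x) ≤
        x ⬝ᵥ P *ᵥ x - y ⬝ᵥ E *ᵥ y := by
  obtain ⟨hDs, hD0⟩ := posSemidef_iff_real.1 hD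
  obtain ⟨Z₀, rfl⟩ := exists_mul_eq_of_ker_le hDs hker
  have hS : ∀ x u, x ⬝ᵥ N₁₁ *ᵥ x + 2 * ((Z₀ *ᵥ x + u) ⬝ᵥ (D * Z₀) *ᵥ x)
      - (Z₀ *ᵥ x + u) ⬝ᵥ D *ᵥ (Z₀ *ᵥ x + u) =
      x ⬝ᵥ (N₁₁ + Z₀ᵀ * D * Z₀) *ᵥ x - u ⬝ᵥ D *ᵥ u := by
    intro x u
    rw [add_mulVec, dotProduct_add, ← mulVec_mulVec, ← mulVec_mulVec, ← mulVec_mulVec,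
      dotProduct_mulVec _ Z₀ᵀ, vecMul_transpose]
    simp only [mulVec_add, dotProduct_add, add_dotProduct]
    rw [dotProduct_mulVec_comm_of_isSymm hDs (Z₀ *ᵥ x) u]
    ring
  have hSpos : (N₁₁ + Z₀ᵀ * D * Z₀).PosSemidef := by
    refine posSemidef_iff_real.2 ⟨?_, fun x => ?_⟩
    · refine hN₁₁.add ?_
      rw [Matrix.IsSymm, transpose_mul, transpose_mul, transpose_transpose, hDs.eq,
        Matrix.mul_assoc]
    · obtain ⟨Z, hZ⟩ := hne
      have h1 := hZ x
      rw [← add_sub_cancel (Z₀ *ᵥ x) (Z *ᵥ x), hS] at h1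
      have := hD0 (Z *ᵥ x - Z₀ *ᵥ x)
      linarith
  obtain ⟨α, β, hα, hβ, hmul⟩ := exists_multiplier_of_centered (P := P) Z₀ hSpos hD hE
    -- The interpolating Y makes Z₀ + Y admissible and sends x to Z₀x + u, so the hypothesis on
    -- matrices applies to this single pair.
    (fun x hx u hu => by
      obtain ⟨Y, hYx, hY⟩ := exists_mulVec_eq_of_quadratic_le hSpos hD hx hu
      have h1 := h (Z₀ + Y) (fun z => by
        rw [add_mulVec, hS]
        exact sub_nonneg.2 (hY z)) x hx
      rwa [add_mulVec, hYx] at h1)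
  refine ⟨α, β, hα, hβ, fun x y => ?_⟩
  have h1 := hmul x (y - Z₀ *ᵥ x)
  rwa [← hS, add_sub_cancel] at h1

/-! ### From the Lyapunov inequality to Schur stability. -/

/-- An eigenvalue z of A is one of Aᵀ, with eigenvector a + ib. Adding the Lyapunov forms at a and b
cancels the cross terms and leaves (1 - |z|²)(aᵀPa + bᵀPb) > 0. -/
theorem isSchurStable_of_lyapunov {n : ℕ} {A P : Matrix (Fin n) (Fin n) ℝ} (hP : P.PosDef)
    (h : (P - A * P * Aᵀ).PosDef) : IsSchurStable A := by
  intro z hz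
  obtain ⟨w, hw, hw0⟩ := hz.exists_hasEigenvector
  have hw1 : A.map Complex.ofReal *ᵥ w = z • w := by
    simpa using Module.End.mem_eigenspace_iff.1 hw
  have hdet : (A.map Complex.ofReal - z • 1).det = 0 := by
    refine exists_mulVec_eq_zero_iff.1 ⟨w, hw0, ?_⟩
    rw [sub_mulVec, smul_mulVec, one_mulVec, hw1, sub_self]
  rw [← det_transpose] at hdet
  obtain ⟨v, hv0, hv⟩ := exists_mulVec_eq_zero_iff.2 hdet
  rw [transpose_sub, transpose_smul, transpose_one, sub_mulVec, smul_mulVec, one_mulVec,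
    sub_eq_zero] at hv
  let a : Fin n → ℝ := fun i => (v i).re
  let b : Fin n → ℝ := fun i => (v i).im
  have ha : Aᵀ *ᵥ a = z.re • a - z.im • b := by
    ext i
    simpa [mulVec, dotProduct, a, b] using congrArg Complex.re (congrFun hv i)
  have hb : Aᵀ *ᵥ b = z.im • a + z.re • b := by
    ext i
    have := congrArg Complex.im (congrFun hv i)
    simp [mulVec, dotProduct, a, b] at this ⊢
    linarith
  have hab : a ≠ 0 ∨ b ≠ 0 := by
    by_contra! hcon
    exact hv0 (funext fun i => Complex.ext (congrFun hcon.1 i) (congrFun hcon.2 i))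
  obtain ⟨hPs, hP0⟩ := posDef_iff_real.1 hP
  have hL : ∀ x, x ⬝ᵥ (P - A * P * Aᵀ) *ᵥ x =
      x ⬝ᵥ P *ᵥ x - (Aᵀ *ᵥ x) ⬝ᵥ P *ᵥ (Aᵀ *ᵥ x) := by
    intro x
    rw [sub_mulVec, dotProduct_sub, ← mulVec_mulVec, ← mulVec_mulVec, dotProduct_mulVec _ A,
      ← mulVec_transpose]
  have hsum : ∀ {S : Matrix (Fin n) (Fin n) ℝ}, S.PosDef →
      0 < a ⬝ᵥ S *ᵥ a + b ⬝ᵥ S *ᵥ b := by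
    intro S hS
    have h1 := (posSemidef_iff_real.1 hS.posSemidef).2
    have h2 := (posDef_iff_real.1 hS).2
    rcases hab with h0 | h0
    · linarith [h2 a h0, h1 b]
    · linarith [h2 b h0, h1 a]
  have h1 := hsum h
  have h2 := hsum hP
  rw [hL, hL, ha, hb] at h1
  simp only [mulVec_add, mulVec_sub, mulVec_smul, dotProduct_add, dotProduct_sub,
    add_dotProduct, sub_dotProduct, smul_dotProduct, dotProduct_smul, smul_eq_mul] at h1
  rw [dotProduct_mulVec_comm_of_isSymm hPs b a] at h1
  have h3 : 0 < (1 - ‖z‖ ^ 2) * (a ⬝ᵥ P *ᵥ a + b ⬝ᵥ P *ᵥ b) := by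
    rw [Complex.sq_norm, Complex.normSq_apply]
    linarith
  have h4 : 0 < 1 - ‖z‖ ^ 2 := pos_of_mul_pos_left h3 h2.le
  exact (sq_lt_one_iff₀ (norm_nonneg z)).1 (by linarith)

/-! ### The LMI as an inequality between quadratic forms. -/

/-- This is the Schur complement of the last block P: completing the square in the last variable z
leaves the P-form of z + P⁻¹Lᵀw, which vanishes at z = -P⁻¹Lᵀw. -/
theorem lmiMatrix_posSemidef_iff {n m : ℕ}
    {N : Matrix (Fin n ⊕ (Fin n ⊕ Fin m)) (Fin n ⊕ (Fin n ⊕ Fin m)) ℝ} (hN : N.IsSymm)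
    {P : Matrix (Fin n) (Fin n) ℝ} (hP : P.PosDef) (L : Matrix (Fin m) (Fin n) ℝ) (β : ℝ) :
    (lmiMatrix N P L β).PosSemidef ↔ ∀ x y w,
      Sum.elim x (Sum.elim y w) ⬝ᵥ N *ᵥ Sum.elim x (Sum.elim y w) + β * (x ⬝ᵥ x) ≤
        x ⬝ᵥ P *ᵥ x - (y + (L * P⁻¹)ᵀ *ᵥ w) ⬝ᵥ P *ᵥ (y + (L * P⁻¹)ᵀ *ᵥ w) := by
  obtain ⟨hPs, hP0⟩ := posDef_iff_real.1 hP
  have hPP : P * P⁻¹ = 1 := Matrix.mul_nonsing_inv _ ((Matrix.isUnit_iff_isUnit_det _).1 hP.isUnit)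
  have hPi : (P⁻¹)ᵀ = P⁻¹ := by rw [transpose_nonsing_inv, hPs.eq]
  have hq : ∀ x y w z, Sum.elim (Sum.elim x (Sum.elim y w)) z ⬝ᵥ
      lmiMatrix N P L β *ᵥ Sum.elim (Sum.elim x (Sum.elim y w)) z =
      x ⬝ᵥ P *ᵥ x - (y + (L * P⁻¹)ᵀ *ᵥ w) ⬝ᵥ P *ᵥ (y + (L * P⁻¹)ᵀ *ᵥ w)
      - (Sum.elim x (Sum.elim y w) ⬝ᵥ N *ᵥ Sum.elim x (Sum.elim y w) + β * (x ⬝ᵥ x))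
      + (z + (L * P⁻¹)ᵀ *ᵥ w) ⬝ᵥ P *ᵥ (z + (L * P⁻¹)ᵀ *ᵥ w) := by
    intro x y w z
    set k := (L * P⁻¹)ᵀ *ᵥ w with hk
    have hPk : P *ᵥ k = Lᵀ *ᵥ w := by
      rw [hk, mulVec_mulVec, transpose_mul, hPi, ← Matrix.mul_assoc, hPP, Matrix.one_mul]
    have hLt : ∀ t, w ⬝ᵥ L *ᵥ t = t ⬝ᵥ P *ᵥ k := fun t => by
      rw [hPk, dotProduct_mulVec, ← mulVec_transpose, dotProduct_comm]
    have hkt : ∀ t, k ⬝ᵥ P *ᵥ t = t ⬝ᵥ P *ᵥ k := fun t =>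
      dotProduct_mulVec_comm_of_isSymm hPs _ _
    simp only [lmiMatrix, sub_mulVec, dotProduct_sub, fromBlocks_mulVec, fromRows_mulVec,
      fromCols_mulVec, Sum.elim_comp_inl, Sum.elim_comp_inr, zero_mulVec, add_zero, zero_add,
      sumElim_dotProduct_sumElim, dotProduct_add, add_dotProduct, mulVec_add, neg_mulVec,
      dotProduct_neg, smul_mulVec, one_mulVec, dotProduct_smul, smul_eq_mul, dotProduct_zero,
      Sum.elim_add_add, hLt, hkt, ← hPk]
    ring
  have hsymm : (lmiMatrix N P L β).IsSymm := by
    unfold lmiMatrix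
    refine Matrix.IsSymm.sub ?_ ?_
    · refine Matrix.IsSymm.fromBlocks ?_ ?_ hPs
      · refine Matrix.IsSymm.fromBlocks (hPs.sub (isSymm_one.smul β)) (by simp) ?_
        exact Matrix.IsSymm.fromBlocks hPs.neg (by simp) isSymm_zero
      · simp [transpose_fromRows]
    · exact Matrix.IsSymm.fromBlocks hN (by simp) isSymm_zero
  rw [posSemidef_iff_real]
  constructor
  · rintro ⟨-, h⟩ x y w
    have h1 := h (Sum.elim (Sum.elim x (Sum.elim y w)) (-((L * P⁻¹)ᵀ *ᵥ w)))
    rw [hq, neg_add_cancel, zero_dotProduct, add_zero] at h1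
    linarith
  · intro h
    refine ⟨hsymm, fun v => ?_⟩
    obtain ⟨x, y, w, z, rfl⟩ : ∃ x y w z, v = Sum.elim (Sum.elim x (Sum.elim y w)) z :=
      ⟨_, _, _, v ∘ Sum.inr, by
        rw [Sum.elim_comp_inl_inr, Sum.elim_comp_inl_inr, Sum.elim_comp_inl_inr]⟩
    rw [hq]
    have h1 := h x y w
    have h2 := (posSemidef_iff_real.1 hP.posSemidef).2 (z + (L * P⁻¹)ᵀ *ᵥ w)
    linarith

/-! ### The data matrix N and the consistent systems. -/

theorem dataMatrix_transpose_mulVec {n m T : ℕ} (U : Matrix (Fin m) (Fin T) ℝ)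
    (X : Matrix (Fin n) (Fin (T + 1)) ℝ) (x : Fin n → ℝ) (y : Fin n ⊕ Fin m → ℝ) :
    (dataMatrix U X)ᵀ *ᵥ Sum.elim x y =
      Sum.elim x ((Xplus X)ᵀ *ᵥ x + (fromRows (-Xminus X) (-U))ᵀ *ᵥ y) := by
  simp [dataMatrix, fromBlocks_transpose, fromBlocks_mulVec]

theorem dataN_form {n m T : ℕ} (Φ : Matrix (Fin n ⊕ Fin T) (Fin n ⊕ Fin T) ℝ)
    (U : Matrix (Fin m) (Fin T) ℝ) (X : Matrix (Fin n) (Fin (T + 1)) ℝ)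
    (v : Fin n ⊕ (Fin n ⊕ Fin m) → ℝ) :
    v ⬝ᵥ dataN Φ U X *ᵥ v =
      ((dataMatrix U X)ᵀ *ᵥ v) ⬝ᵥ Φ *ᵥ ((dataMatrix U X)ᵀ *ᵥ v) := by
  rw [dataN, ← mulVec_mulVec, ← mulVec_mulVec, dotProduct_mulVec _ (dataMatrix U X),
    ← mulVec_transpose]

theorem dataN_isSymm {n m T : ℕ} {Φ : Matrix (Fin n ⊕ Fin T) (Fin n ⊕ Fin T) ℝ}
    (hΦ : Φ.IsSymm) (U : Matrix (Fin m) (Fin T) ℝ) (X : Matrix (Fin n) (Fin (T + 1)) ℝ) :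
    (dataN Φ U X).IsSymm := by
  rw [Matrix.IsSymm, dataN, transpose_mul, transpose_mul, transpose_transpose, hΦ.eq,
    Matrix.mul_assoc]

theorem satisfiesNoiseBound_iff {n T : ℕ} {Φ : Matrix (Fin n ⊕ Fin T) (Fin n ⊕ Fin T) ℝ}
    (hΦ : Φ.IsSymm) (W : Matrix (Fin n) (Fin T) ℝ) :
    SatisfiesNoiseBound Φ W ↔
      ∀ x, 0 ≤ Sum.elim x (Wᵀ *ᵥ x) ⬝ᵥ Φ *ᵥ Sum.elim x (Wᵀ *ᵥ x) := by
  rw [SatisfiesNoiseBound, posSemidef_iff_real]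
  have hform : ∀ x, x ⬝ᵥ ((fromRows (1 : Matrix (Fin n) (Fin n) ℝ) Wᵀ)ᵀ * Φ *
      fromRows (1 : Matrix (Fin n) (Fin n) ℝ) Wᵀ) *ᵥ x =
      Sum.elim x (Wᵀ *ᵥ x) ⬝ᵥ Φ *ᵥ Sum.elim x (Wᵀ *ᵥ x) := by
    intro x
    rw [← mulVec_mulVec, ← mulVec_mulVec, dotProduct_mulVec _ (fromRows _ _)ᵀ, vecMul_transpose,
      fromRows_mulVec, one_mulVec]
  refine ⟨fun h x => by rw [← hform]; exact h.2 x, fun h => ⟨?_, fun x => by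
    rw [hform]; exact h x⟩⟩
  rw [Matrix.IsSymm, transpose_mul, transpose_mul, transpose_transpose, hΦ.eq, Matrix.mul_assoc]

/-- The noise is determined by the system as W = X₊ - AX₋ - BU₋, and the transposed data matrix
sends (x, Aᵀx, Bᵀx) to (x, Wᵀx). -/
theorem mem_consistentSystems_iff {n m T : ℕ}
    {Φ : Matrix (Fin n ⊕ Fin T) (Fin n ⊕ Fin T) ℝ} (hΦ : Φ.IsSymm)
    (U : Matrix (Fin m) (Fin T) ℝ) (X : Matrix (Fin n) (Fin (T + 1)) ℝ)
    (A : Matrix (Fin n) (Fin n) ℝ) (B : Matrix (Fin n) (Fin m) ℝ) :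
    (A, B) ∈ consistentSystems Φ U X ↔
      ∀ x, 0 ≤ Sum.elim x (Sum.elim (Aᵀ *ᵥ x) (Bᵀ *ᵥ x)) ⬝ᵥ
        dataN Φ U X *ᵥ Sum.elim x (Sum.elim (Aᵀ *ᵥ x) (Bᵀ *ᵥ x)) := by
  have hres : ∀ x, (Xplus X)ᵀ *ᵥ x +
      (fromRows (-Xminus X) (-U))ᵀ *ᵥ Sum.elim (Aᵀ *ᵥ x) (Bᵀ *ᵥ x) =
      (Xplus X - A * Xminus X - B * U)ᵀ *ᵥ x := by
    intro x
    rw [transpose_fromRows, fromCols_mulVec, Sum.elim_comp_inl, Sum.elim_comp_inr]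
    simp only [transpose_neg, Matrix.neg_mul, neg_mulVec, mulVec_mulVec, transpose_sub, transpose_mul,
      sub_mulVec]
    abel
  have hmem : (A, B) ∈ consistentSystems Φ U X ↔
      SatisfiesNoiseBound Φ (Xplus X - A * Xminus X - B * U) := by
    constructor
    · rintro ⟨W, hW, h⟩
      have h' : Xplus X = A * Xminus X + B * U + W := h
      convert hW
      rw [h']
      abel
    · intro h
      refine ⟨_, h, ?_⟩
      dsimp only
      abel
  rw [hmem, satisfiesNoiseBound_iff hΦ]
  simp only [dataN_form, dataMatrix_transpose_mulVec, hres]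

theorem fromBlocks_form {p r : Type*} [Fintype p] [Fintype r]
    {N : Matrix (p ⊕ r) (p ⊕ r) ℝ} (hN : N.IsSymm) (x : p → ℝ) (y : r → ℝ) :
    Sum.elim x y ⬝ᵥ N *ᵥ Sum.elim x y = x ⬝ᵥ N.toBlocks₁₁ *ᵥ x +
      2 * (y ⬝ᵥ N.toBlocks₂₁ *ᵥ x) - y ⬝ᵥ (-N.toBlocks₂₂) *ᵥ y := by
  have h12 : N.toBlocks₁₂ = N.toBlocks₂₁ᵀ := by
    ext i j
    exact hN.apply (Sum.inr j) (Sum.inl i)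
  have hx : x ⬝ᵥ N.toBlocks₁₂ *ᵥ y = y ⬝ᵥ N.toBlocks₂₁ *ᵥ x := by
    rw [h12, dotProduct_mulVec, vecMul_transpose, dotProduct_comm]
  conv_lhs => rw [← fromBlocks_toBlocks N]
  rw [fromBlocks_mulVec, sumElim_dotProduct_sumElim]
  simp only [Sum.elim_comp_inl, Sum.elim_comp_inr, dotProduct_add, hx, neg_mulVec,
    dotProduct_neg]
  ring

theorem dataN_blocks {n m T : ℕ} (Φ : Matrix (Fin n ⊕ Fin T) (Fin n ⊕ Fin T) ℝ)
    (U : Matrix (Fin m) (Fin T) ℝ) (X : Matrix (Fin n) (Fin (T + 1)) ℝ) :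
    (dataN Φ U X).toBlocks₁₂ =
      (Φ.toBlocks₁₂ + Xplus X * Φ.toBlocks₂₂) * (fromRows (-Xminus X) (-U))ᵀ ∧
    (dataN Φ U X).toBlocks₂₂ = fromRows (-Xminus X) (-U) * Φ.toBlocks₂₂ *
      (fromRows (-Xminus X) (-U))ᵀ := by
  obtain ⟨a, b, c, d, rfl⟩ : ∃ a b c d, Φ = fromBlocks a b c d :=
    ⟨_, _, _, _, (fromBlocks_toBlocks Φ).symm⟩
  rw [dataN, dataMatrix, fromBlocks_transpose]
  simp [fromBlocks_multiply]

theorem neg_dataN_toBlocks₂₂_posSemidef {n m T : ℕ}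
    {Φ : Matrix (Fin n ⊕ Fin T) (Fin n ⊕ Fin T) ℝ} (hΦ : (-Φ.toBlocks₂₂).PosSemidef)
    (U : Matrix (Fin m) (Fin T) ℝ) (X : Matrix (Fin n) (Fin (T + 1)) ℝ) :
    (-(dataN Φ U X).toBlocks₂₂).PosSemidef := by
  rw [(dataN_blocks Φ U X).2, ← Matrix.neg_mul, ← Matrix.mul_neg]
  simpa using hΦ.mul_mul_conjTranspose_same (fromRows (-Xminus X) (-U))

/-- With R the stacked rows -X₋, -U₋, the equation RΦ₂₂Rᵀv = 0 makes the semidefinite form -Φ₂₂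
vanish at Rᵀv. Hence Φ₂₂ kills Rᵀv, and so does Φ₁₂. -/
theorem dataN_toBlocks₁₂_mulVec_eq_zero {n m T : ℕ}
    {Φ : Matrix (Fin n ⊕ Fin T) (Fin n ⊕ Fin T) ℝ} (hΦ : (-Φ.toBlocks₂₂).PosSemidef)
    (hker : LinearMap.ker Φ.toBlocks₂₂.mulVecLin ≤ LinearMap.ker Φ.toBlocks₁₂.mulVecLin)
    (U : Matrix (Fin m) (Fin T) ℝ) (X : Matrix (Fin n) (Fin (T + 1)) ℝ)
    {v : Fin n ⊕ Fin m → ℝ} (hv : (dataN Φ U X).toBlocks₂₂ *ᵥ v = 0) :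
    (dataN Φ U X).toBlocks₁₂ *ᵥ v = 0 := by
  rw [(dataN_blocks Φ U X).2] at hv
  rw [(dataN_blocks Φ U X).1]
  set R := fromRows (-Xminus X) (-U)
  have h1 : (Rᵀ *ᵥ v) ⬝ᵥ (-Φ.toBlocks₂₂) *ᵥ (Rᵀ *ᵥ v) = 0 := by
    have h2 := congrArg (fun w => v ⬝ᵥ w) hv
    simp only [dotProduct_zero] at h2
    rw [← mulVec_mulVec, ← mulVec_mulVec, dotProduct_mulVec, ← mulVec_transpose] at h2
    rw [neg_mulVec, dotProduct_neg, h2, neg_zero]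
  have h3 := mulVec_eq_zero_of_posSemidef hΦ h1
  rw [neg_mulVec, neg_eq_zero] at h3
  have h4 : Φ.toBlocks₁₂ *ᵥ (Rᵀ *ᵥ v) = 0 := hker (x := Rᵀ *ᵥ v) h3
  rw [← mulVec_mulVec, add_mulVec, ← mulVec_mulVec, h3, h4, mulVec_zero, add_zero]

/-! ### Informativity and the LMI. -/

/-- The Lyapunov form of the closed loop, in transposed coordinates. -/
theorem closedLoop_form {n m : ℕ} (P A : Matrix (Fin n) (Fin n) ℝ) (B : Matrix (Fin n) (Fin m) ℝ)
    (K : Matrix (Fin m) (Fin n) ℝ) (x : Fin n → ℝ) :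
    x ⬝ᵥ (P - (A + B * K) * P * (A + B * K)ᵀ) *ᵥ x = x ⬝ᵥ P *ᵥ x -
      (Aᵀ *ᵥ x + Kᵀ *ᵥ (Bᵀ *ᵥ x)) ⬝ᵥ P *ᵥ (Aᵀ *ᵥ x + Kᵀ *ᵥ (Bᵀ *ᵥ x)) := by
  have h : (A + B * K)ᵀ *ᵥ x = Aᵀ *ᵥ x + Kᵀ *ᵥ (Bᵀ *ᵥ x) := by
    rw [transpose_add, transpose_mul, add_mulVec, mulVec_mulVec]
  rw [sub_mulVec, dotProduct_sub, ← mulVec_mulVec, ← mulVec_mulVec,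
    dotProduct_mulVec _ (A + B * K), ← mulVec_transpose, h]

theorem closedLoop_isSymm {n : ℕ} {P A : Matrix (Fin n) (Fin n) ℝ} (hP : P.IsSymm) :
    (P - A * P * Aᵀ).IsSymm := by
  refine hP.sub ?_
  rw [Matrix.IsSymm, transpose_mul, transpose_mul, transpose_transpose, hP.eq, Matrix.mul_assoc]

theorem lyapunov_of_lmi {n m T : ℕ} {Φ : Matrix (Fin n ⊕ Fin T) (Fin n ⊕ Fin T) ℝ}
    (hΦ : Φ.IsSymm) {U : Matrix (Fin m) (Fin T) ℝ} {X : Matrix (Fin n) (Fin (T + 1)) ℝ}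
    {P : Matrix (Fin n) (Fin n) ℝ} {L : Matrix (Fin m) (Fin n) ℝ} {β : ℝ} (hP : P.PosDef)
    (hβ : 0 < β) (hlmi : (lmiMatrix (dataN Φ U X) P L β).PosSemidef)
    {A : Matrix (Fin n) (Fin n) ℝ} {B : Matrix (Fin n) (Fin m) ℝ}
    (hAB : (A, B) ∈ consistentSystems Φ U X) :
    (P - (A + B * (L * P⁻¹)) * P * (A + B * (L * P⁻¹))ᵀ).PosDef := by
  rw [lmiMatrix_posSemidef_iff (dataN_isSymm hΦ U X) hP] at hlmi
  rw [mem_consistentSystems_iff hΦ] at hAB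
  refine posDef_iff_real.2 ⟨closedLoop_isSymm (posDef_iff_real.1 hP).1, fun x hx => ?_⟩
  rw [closedLoop_form]
  have h1 := hlmi x (Aᵀ *ᵥ x) (Bᵀ *ᵥ x)
  have h2 := hAB x
  have h3 : 0 < β * (x ⬝ᵥ x) := mul_pos hβ
    (lt_of_le_of_ne (Finset.sum_nonneg fun i _ => mul_self_nonneg _)
      (fun h0 => hx (dotProduct_self_eq_zero.1 h0.symm)))
  linarith

/-- The matrix S-lemma is applied with unknown Z = [Aᵀ; Bᵀ] and E = FPFᵀ, F = [I; K], so that E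
measures y + Kᵀw in the P-form. -/
theorem exists_multiplier_of_informative {n m T : ℕ} [Nonempty (Fin n)]
    {Φ : Matrix (Fin n ⊕ Fin T) (Fin n ⊕ Fin T) ℝ} (hΦ : Φ ∈ qmiSet (Fin n) (Fin T))
    {U : Matrix (Fin m) (Fin T) ℝ} {X : Matrix (Fin n) (Fin (T + 1)) ℝ}
    (hne : (consistentSystems Φ U X).Nonempty)
    {K : Matrix (Fin m) (Fin n) ℝ} {P : Matrix (Fin n) (Fin n) ℝ} (hP : P.PosDef)
    (h : ∀ (A : Matrix (Fin n) (Fin n) ℝ) (B : Matrix (Fin n) (Fin m) ℝ),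
      (A, B) ∈ consistentSystems Φ U X → (P - (A + B * K) * P * (A + B * K)ᵀ).PosDef) :
    ∃ α β : ℝ, 0 < α ∧ 0 < β ∧ ∀ x y w,
      α * (Sum.elim x (Sum.elim y w) ⬝ᵥ dataN Φ U X *ᵥ Sum.elim x (Sum.elim y w)) +
        β * (x ⬝ᵥ x) ≤ x ⬝ᵥ P *ᵥ x - (y + Kᵀ *ᵥ w) ⬝ᵥ P *ᵥ (y + Kᵀ *ᵥ w) := by
  obtain ⟨hΦs, hΦ22, -, hker⟩ := hΦ
  have hNs := dataN_isSymm hΦs U X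
  obtain ⟨hPs, hP0⟩ := posDef_iff_real.1 hP
  let F : Matrix (Fin n ⊕ Fin m) (Fin n) ℝ := fromRows 1 K
  have hF : ∀ y w, Fᵀ *ᵥ Sum.elim y w = y + Kᵀ *ᵥ w := by
    intro y w
    simp [F, transpose_fromRows, fromCols_mulVec]
  have hE : ∀ v, v ⬝ᵥ (F * P * Fᵀ) *ᵥ v = (Fᵀ *ᵥ v) ⬝ᵥ P *ᵥ (Fᵀ *ᵥ v) := fun v => by
    rw [← mulVec_mulVec, ← mulVec_mulVec, dotProduct_mulVec _ F, ← mulVec_transpose]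
  have hsplit : ∀ (A : Matrix (Fin n) (Fin n) ℝ) (B : Matrix (Fin n) (Fin m) ℝ) x,
      fromRows Aᵀ Bᵀ *ᵥ x = Sum.elim (Aᵀ *ᵥ x) (Bᵀ *ᵥ x) := fun A B x => fromRows_mulVec _ _ _
  have h12 : (dataN Φ U X).toBlocks₂₁ᵀ = (dataN Φ U X).toBlocks₁₂ := by
    ext i j
    exact hNs.apply (Sum.inl i) (Sum.inr j)
  obtain ⟨α, β, hα, hβ, hmul⟩ := exists_multiplier_of_quadratic_matrix_inequality
    (N₁₁ := (dataN Φ U X).toBlocks₁₁) (P := P) (C := (dataN Φ U X).toBlocks₂₁)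
    (D := -(dataN Φ U X).toBlocks₂₂) (E := F * P * Fᵀ)
    (by ext i j; exact hNs.apply (Sum.inl i) (Sum.inl j))
    (neg_dataN_toBlocks₂₂_posSemidef hΦ22 U X)
    (by simpa using hP.posSemidef.mul_mul_conjTranspose_same F)
    (fun v hv => by
      rw [neg_mulVec, neg_eq_zero] at hv
      rw [h12]
      exact dataN_toBlocks₁₂_mulVec_eq_zero hΦ22 hker U X hv)
    (by
      obtain ⟨⟨A, B⟩, hAB⟩ := hne
      refine ⟨fromRows Aᵀ Bᵀ, fun x => ?_⟩
      rw [← fromBlocks_form hNs, hsplit]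
      exact (mem_consistentSystems_iff hΦs U X A B).1 hAB x)
    (fun Z hZ x hx => by
      obtain ⟨A, B, rfl⟩ : ∃ (A : Matrix (Fin n) (Fin n) ℝ) (B : Matrix (Fin n) (Fin m) ℝ),
          Z = fromRows Aᵀ Bᵀ := ⟨Z.toRows₁ᵀ, Z.toRows₂ᵀ, by simp⟩
      have hAB : (A, B) ∈ consistentSystems Φ U X := by
        refine (mem_consistentSystems_iff hΦs U X A B).2 fun x => ?_
        rw [← hsplit, fromBlocks_form hNs]
        exact hZ x
      have h1 := (posDef_iff_real.1 (h A B hAB)).2 x hx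
      rw [closedLoop_form] at h1
      rw [hE, hsplit, hF]
      linarith)
  have hmul' : ∀ x y w,
      α * (Sum.elim x (Sum.elim y w) ⬝ᵥ dataN Φ U X *ᵥ Sum.elim x (Sum.elim y w)) +
        β * (x ⬝ᵥ x) ≤ x ⬝ᵥ P *ᵥ x - (y + Kᵀ *ᵥ w) ⬝ᵥ P *ᵥ (y + Kᵀ *ᵥ w) := by
    intro x y w
    have h1 := hmul x (Sum.elim y w)
    rwa [← fromBlocks_form hNs, hE, hF] at h1
  refine ⟨α, β, lt_of_le_of_ne hα ?_, hβ, hmul'⟩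
  -- With α = 0, the point x = 0, w = 0, y ≠ 0 would give 0 ≤ -yᵀPy.
  rintro rfl
  have h1 := hmul' 0 (fun _ => 1) 0
  have h2 := hP0 (fun _ => 1) (fun h0 => one_ne_zero (congrFun h0 (Classical.arbitrary (Fin n))))
  simp at h1
  linarith

theorem exists_lmi_of_informative {n m T : ℕ}
    {Φ : Matrix (Fin n ⊕ Fin T) (Fin n ⊕ Fin T) ℝ} (hΦ : Φ ∈ qmiSet (Fin n) (Fin T))
    {U : Matrix (Fin m) (Fin T) ℝ} {X : Matrix (Fin n) (Fin (T + 1)) ℝ}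
    (hne : (consistentSystems Φ U X).Nonempty)
    (h : InformativeForQuadraticStabilization Φ U X) :
    ∃ (P : Matrix (Fin n) (Fin n) ℝ) (L : Matrix (Fin m) (Fin n) ℝ) (β : ℝ),
      P.PosDef ∧ 0 < β ∧ (lmiMatrix (dataN Φ U X) P L β).PosSemidef := by
  have hNs := dataN_isSymm hΦ.1 U X
  obtain ⟨K, P, hP, hK⟩ := h
  rcases isEmpty_or_nonempty (Fin n) with hn | hn
  -- For n = 0 there is no nonzero y to force α > 0. The P-forms vanish, and the LMI reduces to N₂₂
  -- ≤ 0.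
  · refine ⟨P, 0, 1, hP, one_pos, (lmiMatrix_posSemidef_iff hNs hP _ _).2 fun x y w => ?_⟩
    have hx : x = 0 := Subsingleton.elim _ _
    have hzero : ∀ z : Fin n → ℝ, z ⬝ᵥ P *ᵥ z = 0 := fun z => by simp [dotProduct]
    have h1 := (posSemidef_iff_real.1 (neg_dataN_toBlocks₂₂_posSemidef hΦ.2.1 U X)).2
      (Sum.elim y w)
    rw [hzero, hzero, fromBlocks_form hNs, hx]
    simpa using h1
  · obtain ⟨α, β, hα, hβ, hmul⟩ := exists_multiplier_of_informative hΦ hne hP hK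
    have hP' : (α⁻¹ • P).PosDef := by
      obtain ⟨hPs, hP0⟩ := posDef_iff_real.1 hP
      refine posDef_iff_real.2 ⟨hPs.smul _, fun v hv => ?_⟩
      rw [smul_mulVec, dotProduct_smul, smul_eq_mul]
      exact mul_pos (inv_pos.2 hα) (hP0 v hv)
    -- Dividing by α normalises the multiplier of N to 1; L is chosen so that LP⁻¹ for the rescaled
    -- P is still K.
    refine ⟨α⁻¹ • P, K * (α⁻¹ • P), α⁻¹ * β, hP', by positivity,
      (lmiMatrix_posSemidef_iff hNs hP' _ _).2 fun x y w => ?_⟩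
    rw [Matrix.mul_assoc, Matrix.mul_nonsing_inv _
      ((Matrix.isUnit_iff_isUnit_det _).1 hP'.isUnit), Matrix.mul_one]
    have h1 := mul_le_mul_of_nonneg_left (hmul x y w) (inv_pos.2 hα).le
    rw [mul_add, inv_mul_cancel_left₀ hα.ne', ← mul_assoc, mul_sub] at h1
    simpa only [smul_mulVec, dotProduct_smul, smul_eq_mul] using h1

end DataInformativity

theorem mainTheorem2 (n m T : ℕ)
    (Φ : Matrix (Fin n ⊕ Fin T) (Fin n ⊕ Fin T) ℝ)
    (hΦ : Φ ∈ DataInformativity.qmiSet (Fin n) (Fin T))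
    (U : Matrix (Fin m) (Fin T) ℝ) (X : Matrix (Fin n) (Fin (T + 1)) ℝ)
    (As : Matrix (Fin n) (Fin n) ℝ) (Bs : Matrix (Fin n) (Fin m) ℝ)
    (W : Matrix (Fin n) (Fin T) ℝ)
    (hW : DataInformativity.SatisfiesNoiseBound Φ W)
    (hdata : DataInformativity.Xplus X = As * DataInformativity.Xminus X + Bs * U + W) :
    (DataInformativity.InformativeForQuadraticStabilization Φ U X ↔
      ∃ (P : Matrix (Fin n) (Fin n) ℝ) (L : Matrix (Fin m) (Fin n) ℝ) (β : ℝ),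
        P.PosDef ∧ 0 < β ∧
          (DataInformativity.lmiMatrix (DataInformativity.dataN Φ U X) P L β).PosSemidef) ∧
    Fintype.card (DataInformativity.LMIIndex n m) = 3 * n + m ∧
    (∀ (P : Matrix (Fin n) (Fin n) ℝ) (L : Matrix (Fin m) (Fin n) ℝ) (β : ℝ),
      P.PosDef → 0 < β →
        (DataInformativity.lmiMatrix (DataInformativity.dataN Φ U X) P L β).PosSemidef →
        ∀ (A : Matrix (Fin n) (Fin n) ℝ) (B : Matrix (Fin n) (Fin m) ℝ),
          (A, B) ∈ DataInformativity.consistentSystems Φ U X →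
            DataInformativity.IsSchurStable (A + B * (L * P⁻¹))) := by
  have hsymm := hΦ.1
  refine ⟨⟨DataInformativity.exists_lmi_of_informative hΦ ⟨(As, Bs), W, hW, hdata⟩, ?_⟩, ?_, ?_⟩
  · rintro ⟨P, L, β, hP, hβ, hlmi⟩
    exact ⟨L * P⁻¹, P, hP, fun A B hAB =>
      DataInformativity.lyapunov_of_lmi hsymm hP hβ hlmi hAB⟩
  · simp only [DataInformativity.LMIIndex, Fintype.card_sum, Fintype.card_fin]
    ring
  · intro P L β hP hβ hlmi A B hAB
    exact DataInformativity.isSchurStable_of_lyapunov hP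
      (DataInformativity.lyapunov_of_lmi hsymm hP hβ hlmi hAB)
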